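/- Let $1\le s\le d$ be integers and $\sigma>0$. One observes $y_j=\theta_j+\sigma\xi_j$, $j=1,\dots,d$, with $\xi_j$ i.i.d. standard normal and $\theta\in\mathbb R^d$ unknown; $\mathbf P_\theta$ is the law of $y=(y_1,\dots,y_d)$. Let $\|\theta\|_0$ be the number of non-zero components of $\theta$, and for $\delta>0$ put $$\Theta_s(\delta)=\{\theta\in\mathbb R^d:\ \|\theta\|_0=s,\ \theta_j\in\{0,\delta\},\ j=1,\dots,d\},\qquad \Theta_s^*(\delta)=\Big\{\theta\in\mathbb R^d:\ \|\theta\|_0=s,\ \min_{j:\,\theta_j\neq0}|\theta_j|\ge\delta\Big\}.$$ For $\Theta\subseteq\mathbb R^d$, the minimax risk of testing $\theta=0$ against $\theta\in\Theta$ is $$\mathcal R(\Theta)=\inf_\Delta\Big\{\mathbf P_0(\Delta=1)+\sup_{\theta\in\Theta}\mathbf P_\theta(\Delta=0)\Big\},$$ where the infimum is over all $\{0,1\}$-valued statistics $\Delta=\Delta(y)$. A quantity $\lambda=\lambda(s,d,\sigma)>0$ is called the minimax rate of testing on the classes $\Theta_s$ (over a given range of $(s,d)$ and all $\sigma>0$)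 if (i) for any $\varepsilon\in(0,1)$ there exists $A_\varepsilon>0$ such that $\mathcal R(\Theta_s(A\lambda))\le\varepsilon$ for all $A>A_\varepsilon$; (ii) for any $\varepsilon\in(0,1)$ there exists $a_\varepsilon>0$ such that $\mathcal R(\Theta_s(A\lambda))\ge1-\varepsilon$ for all $0<A<a_\varepsilon$; where $A_\varepsilon$ and $a_\varepsilon$ depend only on $\varepsilon$, and not on $s,d,\sigma$. The minimax rate of testing on the classes $\Theta_s^*$ is defined in the same way. Then the minimax rate of testing on $\Theta_s$ is $\lambda=\sigma\sqrt{\log(1+d/s^2)}$ for $s\le\sqrt d$, and the minimax rate of testing on $\Theta_s^*$ is $$\lambda=\begin{cases}\sigma\sqrt{\log(1+d/s^2)} & \text{if } s<\sqrt d,\\ \sigma d^{1/4}/\sqrt s & \text{if } s\ge\sqrt d.\end{cases}$$ -/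

import Mathlib

open MeasureTheory ProbabilityTheory
open scoped ENNReal

noncomputable section

/-- The law `P_θ` on `ℝ^d` of the observations `y_j = θ_j + σ ξ_j`, `j = 1, …, d`, with `ξ_j` i.i.d.
standard normal: the `y_j` are independent and `y_j ∼ N(θ_j, σ²)`. -/
def obsLaw (d : ℕ) (σ : ℝ) (θ : Fin d → ℝ) : Measure (Fin d → ℝ) :=
  Measure.pi fun j => gaussianReal (θ j) (Real.toNNReal (σ ^ 2))

/-- The number `‖θ‖₀` of non-zero components of `θ`. -/
def numNonzero {d : ℕ} (θ : Fin d → ℝ) : ℕ :=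
  (Finset.univ.filter fun j => θ j ≠ 0).card

/-- The class `Θ_s(δ)`: `s` components of `θ` are non-zero and all components lie in `{0, δ}`. -/
def thetaClass (d s : ℕ) (δ : ℝ) : Set (Fin d → ℝ) :=
  {θ | numNonzero θ = s ∧ ∀ j, θ j = 0 ∨ θ j = δ}

/-- The class `Θ*_s(δ)`: `s` components of `θ` are non-zero, and these have absolute value at
least `δ`. -/
def thetaStarClass (d s : ℕ) (δ : ℝ) : Set (Fin d → ℝ) :=
  {θ | numNonzero θ = s ∧ ∀ j, θ j ≠ 0 → δ ≤ |θ j|}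

/-- The risk of a test `Δ` of `θ = 0` against `θ ∈ Θ`: the first type error plus the maximum second
type error. -/
def testRisk (d : ℕ) (σ : ℝ) (Θ : Set (Fin d → ℝ)) (Δ : (Fin d → ℝ) → Fin 2) : ℝ≥0∞ :=
  obsLaw d σ 0 {y | Δ y = 1} + ⨆ θ ∈ Θ, obsLaw d σ θ {y | Δ y = 0}

/-- The minimax risk of testing `θ = 0` against `θ ∈ Θ`: the infimum of the risk over all
`{0,1}`-valued statistics, that is, measurable functions of the observations. -/
def minimaxTestRisk (d : ℕ) (σ : ℝ) (Θ : Set (Fin d → ℝ)) : ℝ≥0∞ :=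
  ⨅ (Δ : (Fin d → ℝ) → Fin 2) (_ : Measurable Δ), testRisk d σ Θ Δ

/-- `rate d s σ` is the (non-asymptotic) minimax rate of testing on the classes `Θ d s`, for all
`σ > 0` and all pairs `(d, s)` in the range `R`. The constants depend on `ε` only. -/
def IsMinimaxTestingRate (R : ℕ → ℕ → Prop) (Θ : (d s : ℕ) → ℝ → Set (Fin d → ℝ))
    (rate : ℕ → ℕ → ℝ → ℝ) : Prop :=
  (∀ (d s : ℕ) (σ : ℝ), R d s → 0 < σ → 0 < rate d s σ) ∧
  (∀ ε : ℝ, 0 < ε → ε < 1 → ∃ A₀ : ℝ, 0 < A₀ ∧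
    ∀ (d s : ℕ) (σ : ℝ), R d s → 0 < σ → ∀ A : ℝ, A₀ < A →
      minimaxTestRisk d σ (Θ d s (A * rate d s σ)) ≤ ENNReal.ofReal ε) ∧
  (∀ ε : ℝ, 0 < ε → ε < 1 → ∃ a₀ : ℝ, 0 < a₀ ∧
    ∀ (d s : ℕ) (σ : ℝ), R d s → 0 < σ → ∀ A : ℝ, 0 < A → A < a₀ →
      ENNReal.ofReal (1 - ε) ≤ minimaxTestRisk d σ (Θ d s (A * rate d s σ)))

end

/-! Lower bounds: by the second-moment method, the risk is at least `1 - ε` as soon as the mixture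
of the `P_θ` over some prior on the class has chi-square divergence at most `ε²` from `P_0`. The
prior places one non-zero entry uniformly at random in each of `s` disjoint blocks of `m = ⌊d / s⌋`
coordinates. The divergence then factors over the blocks and equals `(1 + w / m) ^ s - 1`, where
`w = exp (δ² / σ²) - 1` if the non-zero entries are `δ`, and `w = cosh (δ² / σ²) - 1` if they have
independent random signs. The first is small when `exp (δ² / σ²) - 1 ≲ d / s²`, which gives the
sparse rate; since `cosh x - 1 ≤ x²` for `|x| ≤ 1`, the second is small when `δ⁴ / σ⁴ ≲ d / s²`,
which gives the dense rate.

Upper bounds: by Chebyshev's inequality, a statistic `∑ j, f (y j)` separates the hypotheses as soon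
as its mean shifts by more than its standard deviations. Counting the coordinates with
`|y j| ≥ δ / 2` attains the sparse rate, and `∑ j, (y j)²` attains the dense one.
-/

section SecondMoment

variable {Ω : Type*} [MeasurableSpace Ω] {P : Measure Ω} [IsProbabilityMeasure P] {B : Set Ω}

lemma integral_abs_sub_integral_le_sqrt_variance {g : Ω → ℝ} (hg : MemLp g 2 P) :
    ∫ ω, |g ω - P[g]| ∂P ≤ √Var[g; P] := by
  have hc : MemLp (fun ω => |g ω - P[g]|) 2 P := (hg.sub (memLp_const _)).abs
  have hvar := variance_eq_sub hc
  simp only [Pi.pow_apply, sq_abs] at hvar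
  rw [← variance_eq_integral hg.aemeasurable] at hvar
  refine Real.le_sqrt_of_sq_le ?_
  linarith [variance_nonneg (fun ω => |g ω - P[g]|) P]

lemma one_sub_sqrt_variance_le_measureReal_add_setIntegral_compl {g : Ω → ℝ} (hg : MemLp g 2 P)
    (hmean : P[g] = 1) (hB : MeasurableSet B) :
    1 - √Var[g; P] ≤ P.real B + ∫ ω in Bᶜ, g ω ∂P := by
  have hint : Integrable g P := hg.integrable one_le_two
  have hdev : Integrable (fun ω => g ω - 1) P := hint.sub (integrable_const 1)
  have habs : -∫ ω in Bᶜ, (g ω - 1) ∂P ≤ √Var[g; P] :=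
    calc -∫ ω in Bᶜ, (g ω - 1) ∂P ≤ ∫ ω in Bᶜ, |g ω - 1| ∂P :=
          (neg_le_abs _).trans (abs_integral_le_integral_abs)
      _ ≤ ∫ ω, |g ω - 1| ∂P :=
          setIntegral_le_integral hdev.abs (.of_forall fun _ => abs_nonneg _)
      _ ≤ √Var[g; P] := hmean ▸ integral_abs_sub_integral_le_sqrt_variance hg
  rw [integral_sub hint.integrableOn (integrable_const 1).integrableOn, setIntegral_const,
    smul_eq_mul, mul_one, probReal_compl_eq_one_sub hB] at habs
  linarith

lemma measureReal_withDensity_ofReal {μ : Measure Ω} {f : Ω → ℝ} (hf0 : 0 ≤ f)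
    (hf : Integrable f μ) (hB : MeasurableSet B) :
    (μ.withDensity fun ω => ENNReal.ofReal (f ω)).real B = ∫ ω in B, f ω ∂μ := by
  rw [measureReal_def, withDensity_apply _ hB,
    integral_eq_lintegral_of_nonneg_ae (.of_forall hf0) hf.aestronglyMeasurable.restrict]

-- The mixture of the `Q i` with uniform weights has density `g`, the average of the `f i`; the
-- hypothesis `h` bounds its chi-square divergence from `P` by `ε ^ 2`.
lemma exists_one_sub_le_measureReal_add_of_sum_sum_integral_mul_le {ι : Type*} [Fintype ι]
    [Nonempty ι] {Q : ι → Measure Ω} [∀ i, IsProbabilityMeasure (Q i)] {f : ι → Ω → ℝ}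
    (hf0 : ∀ i, 0 ≤ f i) (hf : ∀ i, MemLp (f i) 2 P)
    (hQ : ∀ i, Q i = P.withDensity fun ω => ENNReal.ofReal (f i ω)) {ε : ℝ} (hε : 0 ≤ ε)
    (h : ∑ i, ∑ k, ∫ ω, f i ω * f k ω ∂P ≤ (Fintype.card ι : ℝ) ^ 2 * (1 + ε ^ 2))
    (hB : MeasurableSet B) :
    ∃ i, 1 - ε ≤ P.real B + (Q i).real Bᶜ := by
  set N : ℝ := (Fintype.card ι : ℝ)
  have hN : 0 < N := Nat.cast_pos.2 Fintype.card_pos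
  let g : Ω → ℝ := fun ω => N⁻¹ * ∑ i, f i ω
  have hint : ∀ i, Integrable (f i) P := fun i => (hf i).integrable one_le_two
  have hg : MemLp g 2 P := (memLp_finsetSum _ fun i _ => hf i).const_mul _
  have hset {C : Set Ω} (hC : MeasurableSet C) :
      ∫ ω in C, g ω ∂P = N⁻¹ * ∑ i, (Q i).real C := by
    rw [integral_const_mul, integral_finsetSum _ fun i _ => (hint i).integrableOn]
    simp only [hQ, measureReal_withDensity_ofReal (hf0 _) (hint _) hC]
  have hmean : P[g] = 1 := by
    rw [← setIntegral_univ, hset .univ]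
    simp only [probReal_univ, Finset.sum_const, Finset.card_univ, nsmul_eq_mul, mul_one]
    exact inv_mul_cancel₀ hN.ne'
  have hsq : P[g ^ 2] ≤ 1 + ε ^ 2 := by
    have hmul : ∀ i k, Integrable (fun ω => f i ω * f k ω) P := fun i k =>
      (hf i).integrable_mul (hf k)
    simp only [g, Pi.pow_apply, mul_pow, sq (∑ i, f i _), Finset.sum_mul_sum]
    rw [integral_const_mul, inv_pow, inv_mul_le_iff₀ (by positivity),
      integral_finsetSum _ fun i _ => integrable_finsetSum _ fun k _ => hmul i k]
    simpa only [integral_finsetSum _ fun k _ => hmul _ k] using h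
  have hvar : √Var[g; P] ≤ ε := by
    rw [variance_eq_sub hg, hmean]
    exact Real.sqrt_le_iff.2 ⟨hε, by linarith⟩
  have key := one_sub_sqrt_variance_le_measureReal_add_setIntegral_compl hg hmean hB
  rw [hset hB.compl] at key
  obtain ⟨i, -, hi⟩ : ∃ i ∈ Finset.univ, N⁻¹ * ∑ k, (Q k).real Bᶜ ≤ (Q i).real Bᶜ := by
    refine Finset.exists_le_of_sum_le Finset.univ_nonempty ?_
    rw [Finset.sum_const, Finset.card_univ, nsmul_eq_mul, mul_inv_cancel_left₀ hN.ne']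
  exact ⟨i, by linarith⟩

end SecondMoment

section Chebyshev

variable {Ω : Type*} [MeasurableSpace Ω] {P : Measure Ω} [IsFiniteMeasure P] {S : Ω → ℝ}
  {T η : ℝ}

lemma measure_ge_le_of_variance_le (hS : MemLp S 2 P) (hT : P[S] < T)
    (hvar : Var[S; P] ≤ η * (T - P[S]) ^ 2) :
    P {ω | T ≤ S ω} ≤ ENNReal.ofReal η := by
  have hgap : 0 < T - P[S] := sub_pos.2 hT
  calc P {ω | T ≤ S ω} ≤ P {ω | T - P[S] ≤ |S ω - P[S]|} :=
        measure_mono fun ω (hω : T ≤ S ω) => (sub_le_sub_right hω _).trans (le_abs_self _)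
    _ ≤ ENNReal.ofReal (Var[S; P] / (T - P[S]) ^ 2) := meas_ge_le_variance_div_sq hS hgap
    _ ≤ ENNReal.ofReal η := ENNReal.ofReal_le_ofReal ((div_le_iff₀ (by positivity)).2 hvar)

lemma measure_lt_le_of_variance_le (hS : MemLp S 2 P) (hT : T < P[S])
    (hvar : Var[S; P] ≤ η * (P[S] - T) ^ 2) :
    P {ω | S ω < T} ≤ ENNReal.ofReal η := by
  have hneg : P[-S] = -P[S] := integral_neg S
  calc P {ω | S ω < T} ≤ P {ω | -T ≤ (-S) ω} :=
        measure_mono fun ω (hω : S ω < T) => (neg_le_neg hω.le : -T ≤ -S ω)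
    _ ≤ ENNReal.ofReal η := by
        refine measure_ge_le_of_variance_le hS.neg (by rw [hneg]; linarith) ?_
        rw [variance_neg, hneg]
        exact hvar.trans_eq (by ring)

end Chebyshev

section ProductMeasure

variable {ι : Type*} [Fintype ι] {X : ι → Type*} [∀ i, MeasurableSpace (X i)]
  {μ : ∀ i, Measure (X i)} [∀ i, IsProbabilityMeasure (μ i)]

lemma lintegral_pi_prod {f : ∀ i, X i → ℝ≥0∞} (hf : ∀ i, Measurable (f i)) :
    ∫⁻ x, ∏ i, f i (x i) ∂Measure.pi μ = ∏ i, ∫⁻ x, f i x ∂μ i := by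
  rw [lintegral_prod_eq_prod_lintegral_of_indepFun Finset.univ _
    (iIndepFun_pi fun i => (hf i).aemeasurable) fun i => (hf i).comp (measurable_pi_apply i)]
  exact Finset.prod_congr rfl fun i _ => (measurePreserving_eval μ i).lintegral_comp (hf i)

lemma pi_eq_withDensity_prod {ν : ∀ i, Measure (X i)} [∀ i, SigmaFinite (ν i)]
    {f : ∀ i, X i → ℝ≥0∞} (hf : ∀ i, Measurable (f i)) (hν : ∀ i, ν i = (μ i).withDensity (f i)) :
    Measure.pi ν = (Measure.pi μ).withDensity fun x => ∏ i, f i (x i) := by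
  refine Measure.pi_eq fun B hB => ?_
  have hind : (Set.univ.pi B).indicator (fun x => ∏ i, f i (x i)) =
      fun x => ∏ i, (B i).indicator (f i) (x i) := by
    classical
    ext x
    simp only [Set.indicator_apply, Finset.prod_ite_zero, Set.mem_univ_pi, Finset.mem_univ,
      true_imp_iff]
  rw [withDensity_apply _ (.univ_pi hB), ← lintegral_indicator (.univ_pi hB), hind,
    lintegral_pi_prod fun i => (hf i).indicator (hB i)]
  simp only [lintegral_indicator (hB _), hν, withDensity_apply _ (hB _)]

lemma memLp_sum_pi {f : ∀ i, X i → ℝ} (hf : ∀ i, MemLp (f i) 2 (μ i)) :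
    MemLp (fun x => ∑ i, f i (x i)) 2 (Measure.pi μ) :=
  memLp_finsetSum _ fun i _ => (hf i).comp_measurePreserving (measurePreserving_eval μ i)

lemma integral_sum_pi {f : ∀ i, X i → ℝ} (hf : ∀ i, Integrable (f i) (μ i)) :
    ∫ x, ∑ i, f i (x i) ∂Measure.pi μ = ∑ i, ∫ x, f i x ∂μ i := by
  rw [integral_finsetSum _ fun i _ => integrable_comp_eval (hf i)]
  exact Finset.sum_congr rfl fun i _ => integral_comp_eval (hf i).aestronglyMeasurable

end ProductMeasure

section GaussianLikelihoodRatio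

/-- The likelihood ratio at `x` of the Gaussian law `N(a, v)` with respect to `N(0, v)`. -/
noncomputable def gaussianLR (v a x : ℝ) : ℝ := Real.exp ((a * x - a ^ 2 / 2) / v)

lemma gaussianLR_nonneg (v a x : ℝ) : 0 ≤ gaussianLR v a x := (Real.exp_pos _).le

lemma measurable_gaussianLR (v a : ℝ) : Measurable (gaussianLR v a) := by
  unfold gaussianLR
  fun_prop

lemma gaussianReal_eq_withDensity_gaussianLR (a : ℝ) {v : NNReal} (hv : v ≠ 0) :
    gaussianReal a v =
      (gaussianReal 0 v).withDensity fun x => ENNReal.ofReal (gaussianLR v a x) := by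
  rw [gaussianReal_of_var_ne_zero _ hv, gaussianReal_of_var_ne_zero _ hv,
    ← withDensity_mul _ (measurable_gaussianPDF _ _) (measurable_gaussianLR _ _).ennreal_ofReal]
  congr 1
  ext x
  have hv' : (v : ℝ) ≠ 0 := NNReal.coe_ne_zero.2 hv
  simp only [Pi.mul_apply, gaussianPDF_def, gaussianPDFReal_def, gaussianLR]
  rw [← ENNReal.ofReal_mul (by positivity), mul_assoc (√_)⁻¹, ← Real.exp_add]
  congr 3
  field_simp
  ring

lemma gaussianLR_mul (v a b x : ℝ) :
    gaussianLR v a x * gaussianLR v b x =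
      Real.exp (-((a ^ 2 + b ^ 2) / 2 / v)) * Real.exp ((a + b) / v * x) := by
  rw [gaussianLR, gaussianLR, ← Real.exp_add, ← Real.exp_add]
  congr 1
  ring

lemma integrable_gaussianLR_mul (v : NNReal) (a b : ℝ) :
    Integrable (fun x => gaussianLR v a x * gaussianLR v b x) (gaussianReal 0 v) := by
  simp only [gaussianLR_mul]
  exact (integrable_exp_mul_gaussianReal _).const_mul _

lemma integral_gaussianLR_mul {v : NNReal} (hv : v ≠ 0) (a b : ℝ) :
    ∫ x, gaussianLR v a x * gaussianLR v b x ∂gaussianReal 0 v = Real.exp (a * b / v) := by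
  have hv' : (v : ℝ) ≠ 0 := NNReal.coe_ne_zero.2 hv
  have hmgf : ∫ x, Real.exp ((a + b) / v * x) ∂gaussianReal 0 v = _ :=
    congrFun (mgf_fun_id_gaussianReal (μ := 0) (v := v)) ((a + b) / v)
  simp only [gaussianLR_mul]
  rw [integral_const_mul, hmgf, ← Real.exp_add]
  congr 1
  field_simp
  ring

end GaussianLikelihoodRatio

section Observations

variable {d : ℕ} {σ : ℝ}

instance isProbabilityMeasure_obsLaw (d : ℕ) (σ : ℝ) (θ : Fin d → ℝ) :
    IsProbabilityMeasure (obsLaw d σ θ) := by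
  unfold obsLaw
  infer_instance

/-- The likelihood ratio at `y` of `obsLaw d σ θ` with respect to `obsLaw d σ 0`. -/
noncomputable def obsLR (σ : ℝ) (θ y : Fin d → ℝ) : ℝ :=
  ∏ j, gaussianLR (σ ^ 2).toNNReal (θ j) (y j)

lemma obsLR_nonneg (σ : ℝ) (θ : Fin d → ℝ) : 0 ≤ obsLR σ θ := fun _ =>
  Finset.prod_nonneg fun _ _ => gaussianLR_nonneg _ _ _

lemma obsLR_mul (σ : ℝ) (θ η y : Fin d → ℝ) :
    obsLR σ θ y * obsLR σ η y =
      ∏ j, gaussianLR (σ ^ 2).toNNReal (θ j) (y j) * gaussianLR (σ ^ 2).toNNReal (η j) (y j) :=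
  Finset.prod_mul_distrib.symm

lemma memLp_obsLR (σ : ℝ) (θ : Fin d → ℝ) : MemLp (obsLR σ θ) 2 (obsLaw d σ 0) := by
  have hmeas : Measurable (obsLR σ θ) := Finset.univ.measurable_fun_prod fun j _ =>
    (measurable_gaussianLR _ _).comp (measurable_pi_apply j)
  rw [memLp_two_iff_integrable_sq hmeas.aestronglyMeasurable]
  simp only [sq (obsLR σ θ _), obsLR_mul]
  exact .fintype_prod_dep fun j => integrable_gaussianLR_mul _ (θ j) (θ j)

lemma toNNReal_sq_ne_zero (hσ : σ ≠ 0) : (σ ^ 2).toNNReal ≠ 0 :=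
  (Real.toNNReal_pos.2 (by positivity)).ne'

lemma integral_obsLR_mul (hσ : σ ≠ 0) (θ η : Fin d → ℝ) :
    ∫ y, obsLR σ θ y * obsLR σ η y ∂obsLaw d σ 0 = Real.exp ((∑ j, θ j * η j) / σ ^ 2) := by
  simp only [obsLR_mul, obsLaw, Pi.zero_apply]
  rw [integral_fintype_prod_eq_prod (𝕜 := ℝ) fun j x =>
    gaussianLR (σ ^ 2).toNNReal (θ j) x * gaussianLR (σ ^ 2).toNNReal (η j) x]
  simp only [integral_gaussianLR_mul (toNNReal_sq_ne_zero hσ)]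
  rw [Real.coe_toNNReal _ (sq_nonneg σ), Finset.sum_div, Real.exp_sum]

lemma obsLaw_eq_withDensity (hσ : σ ≠ 0) (θ : Fin d → ℝ) :
    obsLaw d σ θ = (obsLaw d σ 0).withDensity fun y => ENNReal.ofReal (obsLR σ θ y) := by
  simp only [obsLR, ENNReal.ofReal_prod_of_nonneg fun j _ => gaussianLR_nonneg _ (θ j) _]
  exact pi_eq_withDensity_prod
    (f := fun j x => ENNReal.ofReal (gaussianLR (σ ^ 2).toNNReal (θ j) x))
    (fun j => (measurable_gaussianLR _ (θ j)).ennreal_ofReal)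
    fun j => gaussianReal_eq_withDensity_gaussianLR (θ j) (toNNReal_sq_ne_zero hσ)

end Observations

section MinimaxRisk

variable {d : ℕ} {σ : ℝ} {Θ : Set (Fin d → ℝ)}

lemma le_minimaxTestRisk_of_forall_exists {c : ℝ}
    (h : ∀ B, MeasurableSet B → ∃ θ ∈ Θ, c ≤ (obsLaw d σ 0).real B + (obsLaw d σ θ).real Bᶜ) :
    ENNReal.ofReal c ≤ minimaxTestRisk d σ Θ := by
  refine le_iInf₂ fun Δ hΔ => ?_
  have hcompl : {y | Δ y = 1}ᶜ = {y | Δ y = 0} := by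
    ext y
    simp only [Set.mem_compl_iff, Set.mem_ofPred_eq]
    omega
  obtain ⟨θ, hθ, hc⟩ := h {y | Δ y = 1} (hΔ (measurableSet_singleton 1))
  calc ENNReal.ofReal c ≤ obsLaw d σ 0 {y | Δ y = 1} + obsLaw d σ θ {y | Δ y = 0} := by
        refine (ENNReal.ofReal_le_ofReal hc).trans_eq ?_
        rw [ENNReal.ofReal_add measureReal_nonneg measureReal_nonneg, ofReal_measureReal,
          ofReal_measureReal, hcompl]
    _ ≤ testRisk d σ Θ Δ := by
        unfold testRisk
        gcongr
        exact le_iSup₂ (f := fun θ (_ : θ ∈ Θ) => obsLaw d σ θ {y | Δ y = 0}) θ hθ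

lemma minimaxTestRisk_le_of_measurableSet {B : Set (Fin d → ℝ)} (hB : MeasurableSet B)
    {α β : ℝ≥0∞} (h0 : obsLaw d σ 0 B ≤ α) (h1 : ∀ θ ∈ Θ, obsLaw d σ θ Bᶜ ≤ β) :
    minimaxTestRisk d σ Θ ≤ α + β := by
  classical
  let Δ : (Fin d → ℝ) → Fin 2 := fun y => if y ∈ B then 1 else 0
  have hone : {y | Δ y = 1} = B := by ext y; by_cases hy : y ∈ B <;> simp [Δ, hy]
  have hzero : {y | Δ y = 0} = Bᶜ := by ext y; by_cases hy : y ∈ B <;> simp [Δ, hy]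
  refine (iInf₂_le Δ (.ite hB measurable_const measurable_const)).trans ?_
  rw [testRisk, hone, hzero]
  exact add_le_add h0 (iSup₂_le h1)

lemma minimaxTestRisk_mono {Θ' : Set (Fin d → ℝ)} (h : Θ ⊆ Θ') :
    minimaxTestRisk d σ Θ ≤ minimaxTestRisk d σ Θ' :=
  iInf₂_mono fun _ _ => add_le_add_right (biSup_mono h) _

lemma le_minimaxTestRisk_of_family (hσ : σ ≠ 0) {ι : Type*} [Fintype ι] [Nonempty ι]
    {θ : ι → Fin d → ℝ} (hθ : ∀ i, θ i ∈ Θ) {ε : ℝ} (hε : 0 ≤ ε)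
    (h : ∑ i, ∑ k, Real.exp ((∑ j, θ i j * θ k j) / σ ^ 2) ≤
      (Fintype.card ι : ℝ) ^ 2 * (1 + ε ^ 2)) :
    ENNReal.ofReal (1 - ε) ≤ minimaxTestRisk d σ Θ := by
  simp only [← integral_obsLR_mul hσ] at h
  refine le_minimaxTestRisk_of_forall_exists fun B hB => ?_
  obtain ⟨i, hi⟩ := exists_one_sub_le_measureReal_add_of_sum_sum_integral_mul_le
    (fun i => obsLR_nonneg σ (θ i)) (fun i => memLp_obsLR σ (θ i))
    (fun i => obsLaw_eq_withDensity hσ (θ i)) hε h hB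
  exact ⟨θ i, hθ i, hi⟩

lemma minimaxTestRisk_le_of_variance_le {S : (Fin d → ℝ) → ℝ} {T ε : ℝ} (hS : Measurable S)
    (hε : 0 ≤ ε) (hLp : ∀ θ, MemLp S 2 (obsLaw d σ θ)) (h0 : (obsLaw d σ 0)[S] < T)
    (hvar0 : Var[S; obsLaw d σ 0] ≤ ε / 2 * (T - (obsLaw d σ 0)[S]) ^ 2)
    (h1 : ∀ θ ∈ Θ, T < (obsLaw d σ θ)[S] ∧
      Var[S; obsLaw d σ θ] ≤ ε / 2 * ((obsLaw d σ θ)[S] - T) ^ 2) :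
    minimaxTestRisk d σ Θ ≤ ENNReal.ofReal ε := by
  have hcompl : {y | T ≤ S y}ᶜ = {y | S y < T} := by ext y; simp
  refine (minimaxTestRisk_le_of_measurableSet (measurableSet_le measurable_const hS)
    (measure_ge_le_of_variance_le (hLp 0) h0 hvar0) fun θ hθ => hcompl ▸
      measure_lt_le_of_variance_le (hLp θ) (h1 θ hθ).1 (h1 θ hθ).2).trans_eq ?_
  rw [← ENNReal.ofReal_add (by positivity) (by positivity), add_halves]

end MinimaxRisk

section BlockPrior

lemma sum_sum_prod_eq_pow {ι γ R : Type*} [Fintype ι] [DecidableEq ι] [Fintype γ] [CommSemiring R]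
    (w : γ → γ → R) :
    ∑ f : ι → γ, ∑ g : ι → γ, ∏ i, w (f i) (g i) = (∑ x, ∑ y, w x y) ^ Fintype.card ι := by
  have hprod := Fintype.prod_sum fun (_ : ι) x => ∑ y, w x y
  rw [Finset.prod_const, Finset.card_univ] at hprod
  rw [hprod]
  exact Finset.sum_congr rfl fun f _ => (Fintype.prod_sum fun i y => w (f i) y).symm

variable {d : ℕ} {ι κ β : Type*}

/-- A vector with exactly one non-zero entry in each of the disjoint blocks of coordinates
`{e (i, k) | k}`: in block `i` the value `v (f i).2` sits at position `(f i).1`. With `f` uniformly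
distributed this is the least favourable prior behind the lower bounds. -/
noncomputable def blockVector [DecidableEq κ] (e : ι × κ ↪ Fin d) (v : β → ℝ) (f : ι → κ × β) :
    Fin d → ℝ :=
  Function.extend e (fun x => if (f x.1).1 = x.2 then v (f x.1).2 else 0) 0

section

variable [DecidableEq κ] (e : ι × κ ↪ Fin d) (v : β → ℝ) (f g : ι → κ × β)

lemma blockVector_apply (x : ι × κ) :
    blockVector e v f (e x) = if (f x.1).1 = x.2 then v (f x.1).2 else 0 :=
  e.injective.extend_apply _ _ _

lemma blockVector_of_notMem_range {j : Fin d} (hj : j ∉ Set.range e) : blockVector e v f j = 0 :=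
  Function.extend_apply' _ _ _ hj

lemma blockVector_eq_zero_or_mem_range (j : Fin d) :
    blockVector e v f j = 0 ∨ blockVector e v f j ∈ Set.range v := by
  by_cases hj : j ∈ Set.range e
  · obtain ⟨x, rfl⟩ := hj
    rw [blockVector_apply]
    split_ifs
    · exact .inr ⟨_, rfl⟩
    · exact .inl rfl
  · exact .inl (blockVector_of_notMem_range e v f hj)

variable {v} in
lemma numNonzero_blockVector [Fintype ι] (hv : ∀ b, v b ≠ 0) :
    numNonzero (blockVector e v f) = Fintype.card ι := by
  have hinj : Function.Injective fun i => e (i, (f i).1) := fun _ _ h =>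
    congrArg Prod.fst (e.injective h)
  have hsupp : (Finset.univ.filter fun j => blockVector e v f j ≠ 0) =
      Finset.univ.map ⟨fun i => e (i, (f i).1), hinj⟩ := by
    ext j
    simp only [Finset.mem_filter, Finset.mem_univ, true_and, Finset.mem_map,
      Function.Embedding.coeFn_mk]
    constructor
    · intro hne
      obtain ⟨x, rfl⟩ : j ∈ Set.range e :=
        not_not.1 fun hj => hne (blockVector_of_notMem_range e v f hj)
      rw [blockVector_apply, ne_eq, ite_eq_right_iff, Classical.not_imp] at hne
      exact ⟨x.1, by rw [hne.1]⟩
    · rintro ⟨i, rfl⟩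
      rw [blockVector_apply, if_pos rfl]
      exact hv _
  rw [numNonzero, hsupp, Finset.card_map, Finset.card_univ]

lemma sum_blockVector_mul [Fintype ι] [Finite κ] :
    ∑ j, blockVector e v f j * blockVector e v g j =
      ∑ i, if (f i).1 = (g i).1 then v (f i).2 * v (g i).2 else 0 := by
  cases nonempty_fintype κ
  have hrange : ∑ j ∈ Finset.univ.map e, blockVector e v f j * blockVector e v g j =
      ∑ j, blockVector e v f j * blockVector e v g j := by
    refine Finset.sum_subset (Finset.subset_univ _) fun j _ hj => ?_
    rw [blockVector_of_notMem_range e v f (by simpa using hj), zero_mul]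
  rw [← hrange, Finset.sum_map, Fintype.sum_prod_type]
  refine Finset.sum_congr rfl fun i _ => ?_
  simp only [blockVector_apply, ite_mul, zero_mul, mul_ite, mul_zero, Finset.sum_ite_eq,
    Finset.mem_univ, if_true]

end

variable [Fintype ι] [DecidableEq ι] [Fintype κ] [DecidableEq κ] [Fintype β] (v : β → ℝ)

lemma sum_sum_exp_blockVector (e : ι × κ ↪ Fin d) (c : ℝ) :
    ∑ f, ∑ g, Real.exp ((∑ j, blockVector e v f j * blockVector e v g j) / c) =
      (∑ x : κ × β, ∑ y : κ × β,
        Real.exp ((if x.1 = y.1 then v x.2 * v y.2 else 0) / c)) ^ Fintype.card ι := by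
  simp only [sum_blockVector_mul, Finset.sum_div, Real.exp_sum]
  exact sum_sum_prod_eq_pow fun x y : κ × β =>
    Real.exp ((if x.1 = y.1 then v x.2 * v y.2 else 0) / c)

lemma sum_sum_exp_ite_fst_eq (c : ℝ) :
    ∑ x : κ × β, ∑ y : κ × β, Real.exp ((if x.1 = y.1 then v x.2 * v y.2 else 0) / c) =
      (Fintype.card κ * Fintype.card β : ℝ) ^ 2 +
        Fintype.card κ * ((∑ a, ∑ b, Real.exp (v a * v b / c)) - (Fintype.card β : ℝ) ^ 2) := by
  have hsplit : ∀ x y : κ × β, Real.exp ((if x.1 = y.1 then v x.2 * v y.2 else 0) / c) =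
      1 + if x.1 = y.1 then Real.exp (v x.2 * v y.2 / c) - 1 else 0 := fun x y => by
    split_ifs <;> simp
  have hdiag : ∀ (k : κ) (a : β), ∑ l, ∑ b,
      (if k = l then Real.exp (v a * v b / c) - 1 else 0) =
        ∑ b, (Real.exp (v a * v b / c) - 1) := fun k a => by
    rw [Finset.sum_comm]
    simp only [Finset.sum_ite_eq, Finset.mem_univ, if_true]
  simp only [hsplit, Fintype.sum_prod_type, Finset.sum_add_distrib, hdiag, Finset.sum_const,
    Finset.card_univ, Fintype.card_prod, nsmul_eq_mul, mul_one, Finset.sum_sub_distrib]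
  push_cast
  ring

lemma sum_sum_exp_ite_fst_le [Nonempty κ] {c w : ℝ}
    (hw : ∑ a, ∑ b, Real.exp (v a * v b / c) ≤ (Fintype.card β : ℝ) ^ 2 * (1 + w)) :
    ∑ x : κ × β, ∑ y : κ × β, Real.exp ((if x.1 = y.1 then v x.2 * v y.2 else 0) / c) ≤
      (Fintype.card (κ × β) : ℝ) ^ 2 * (1 + w / Fintype.card κ) := by
  have : (0 : ℝ) < Fintype.card κ := Nat.cast_pos.2 Fintype.card_pos
  rw [sum_sum_exp_ite_fst_eq, Fintype.card_prod, Nat.cast_mul]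
  calc (Fintype.card κ * Fintype.card β : ℝ) ^ 2 +
        Fintype.card κ * ((∑ a, ∑ b, Real.exp (v a * v b / c)) - (Fintype.card β : ℝ) ^ 2)
      ≤ (Fintype.card κ * Fintype.card β : ℝ) ^ 2 +
        Fintype.card κ * ((Fintype.card β : ℝ) ^ 2 * (1 + w) - (Fintype.card β : ℝ) ^ 2) := by
        gcongr
    _ = (Fintype.card κ * Fintype.card β : ℝ) ^ 2 * (1 + w / Fintype.card κ) := by
        field_simp
        ring

end BlockPrior

section LowerBounds

lemma le_two_mul_mul_div {d s : ℕ} (hs : 1 ≤ s) (hsd : s ≤ d) : d ≤ 2 * (s * (d / s)) := by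
  have hpos : s ≤ s * (d / s) := Nat.le_mul_of_pos_right s (Nat.div_pos hsd hs)
  have hlt : d < s * (d / s + 1) := Nat.lt_mul_div_succ d hs
  linarith [mul_add_one s (d / s)]

lemma one_add_div_pow_le {s : ℕ} {w m y : ℝ} (hm : 0 < m) (hw : 0 ≤ 1 + w / m) (hy : 0 < y)
    (h : s * w ≤ m * Real.log y) : (1 + w / m) ^ s ≤ y :=
  calc (1 + w / m) ^ s ≤ Real.exp (w / m) ^ s := by
        gcongr
        linarith [Real.add_one_le_exp (w / m)]
    _ = Real.exp (s * w / m) := by rw [← Real.exp_nat_mul, mul_div_assoc]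
    _ ≤ Real.exp (Real.log y) := Real.exp_le_exp.2 ((div_le_iff₀' hm).2 h)
    _ = y := Real.exp_log hy

variable {d s : ℕ} {σ ε δ : ℝ}

lemma le_minimaxTestRisk_of_block {Θ : Set (Fin d → ℝ)} {β : Type*} [Fintype β] [Nonempty β]
    {v : β → ℝ} {w : ℝ} (hs : 1 ≤ s) (hsd : s ≤ d) (hσ : σ ≠ 0) (hε : 0 ≤ ε) (hv : ∀ b, v b ≠ 0)
    (hΘ : ∀ θ, numNonzero θ = s → (∀ j, θ j = 0 ∨ θ j ∈ Set.range v) → θ ∈ Θ) (hw0 : 0 ≤ w)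
    (hw : ∑ a, ∑ b, Real.exp (v a * v b / σ ^ 2) ≤ (Fintype.card β : ℝ) ^ 2 * (1 + w))
    (hle : 2 * (s : ℝ) ^ 2 * w ≤ d * Real.log (1 + ε ^ 2)) :
    ENNReal.ofReal (1 - ε) ≤ minimaxTestRisk d σ Θ := by
  have hm : 0 < d / s := Nat.div_pos hsd hs
  have : Nonempty (Fin (d / s)) := ⟨⟨0, hm⟩⟩
  let e : Fin s × Fin (d / s) ↪ Fin d :=
    finProdFinEquiv.toEmbedding.trans (Fin.castLEEmb (Nat.mul_div_le d s))
  refine le_minimaxTestRisk_of_family hσ (θ := blockVector e v) (fun f => hΘ _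
    ((numNonzero_blockVector e f hv).trans (Fintype.card_fin s))
    (blockVector_eq_zero_or_mem_range e v f)) hε ?_
  have hpow : (1 + w / (d / s : ℕ)) ^ s ≤ 1 + ε ^ 2 := by
    refine one_add_div_pow_le (Nat.cast_pos.2 hm) (by positivity) (by positivity) ?_
    have hd : (d : ℝ) ≤ 2 * (s * (d / s : ℕ)) := mod_cast le_two_mul_mul_div hs hsd
    have : (0 : ℝ) < s := Nat.cast_pos.2 hs
    have hlog : 0 ≤ Real.log (1 + ε ^ 2) := Real.log_nonneg (by nlinarith)
    refine le_of_mul_le_mul_left ?_ (show 0 < 2 * (s : ℝ) by positivity)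
    calc 2 * (s : ℝ) * (s * w) = 2 * s ^ 2 * w := by ring
      _ ≤ d * Real.log (1 + ε ^ 2) := hle
      _ ≤ 2 * (s * (d / s : ℕ)) * Real.log (1 + ε ^ 2) := by gcongr
      _ = 2 * s * ((d / s : ℕ) * Real.log (1 + ε ^ 2)) := by ring
  have hblock := sum_sum_exp_ite_fst_le (κ := Fin (d / s)) v hw
  rw [sum_sum_exp_blockVector, Fintype.card_fun, Nat.cast_pow, Fintype.card_fin s]
  rw [Fintype.card_fin] at hblock
  calc _ ≤ ((Fintype.card (Fin (d / s) × β) : ℝ) ^ 2 * (1 + w / (d / s : ℕ))) ^ s := by gcongr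
    _ = ((Fintype.card (Fin (d / s) × β) : ℝ) ^ s) ^ 2 * (1 + w / (d / s : ℕ)) ^ s := by
      rw [mul_pow, pow_right_comm]
    _ ≤ ((Fintype.card (Fin (d / s) × β) : ℝ) ^ s) ^ 2 * (1 + ε ^ 2) := by gcongr

lemma le_minimaxTestRisk_thetaClass (hs : 1 ≤ s) (hsd : s ≤ d) (hσ : σ ≠ 0) (hε : 0 ≤ ε)
    (hδ : δ ≠ 0) (hle : 2 * (s : ℝ) ^ 2 * (Real.exp (δ ^ 2 / σ ^ 2) - 1) ≤
      d * Real.log (1 + ε ^ 2)) :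
    ENNReal.ofReal (1 - ε) ≤ minimaxTestRisk d σ (thetaClass d s δ) := by
  refine le_minimaxTestRisk_of_block hs hsd hσ hε (v := fun _ : Unit => δ) (fun _ => hδ)
    (fun θ hcard hval => ⟨hcard, fun j => (hval j).imp_right fun ⟨_, h⟩ => h.symm⟩)
    (sub_nonneg.2 (Real.one_le_exp (by positivity))) ?_ hle
  simp [sq]

lemma le_minimaxTestRisk_thetaStarClass (hs : 1 ≤ s) (hsd : s ≤ d) (hσ : σ ≠ 0) (hε : 0 ≤ ε)
    (hδ : 0 < δ) (hle : 2 * (s : ℝ) ^ 2 * (Real.cosh (δ ^ 2 / σ ^ 2) - 1) ≤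
      d * Real.log (1 + ε ^ 2)) :
    ENNReal.ofReal (1 - ε) ≤ minimaxTestRisk d σ (thetaStarClass d s δ) := by
  refine le_minimaxTestRisk_of_block hs hsd hσ hε (v := fun b : Bool => if b then δ else -δ)
    (fun b => by cases b <;> simp [hδ.ne']) (fun θ hcard hval => ⟨hcard, fun j hj => ?_⟩)
    (sub_nonneg.2 (Real.one_le_cosh _)) (le_of_eq ?_) hle
  · obtain ⟨b, hb⟩ := (hval j).resolve_left hj
    cases b <;> simp [← hb, abs_of_pos hδ]
  · simp only [Fintype.univ_bool, mul_ite, ite_mul, ← sq, neg_mul, mul_neg, Finset.mem_singleton,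
      Bool.true_eq_false, not_false_eq_true, Finset.sum_insert, ↓reduceIte, Finset.sum_singleton,
      Bool.false_eq_true, neg_div, neg_neg, Fintype.card_bool, Nat.cast_ofNat, Real.cosh_eq,
      add_sub_cancel]
    ring

end LowerBounds

section GaussianMoments

open Polynomial

lemma hasDerivAt_eval_mul_exp (a v : ℝ) (p : ℝ[X]) (t : ℝ) :
    HasDerivAt (fun t => p.eval (a + v * t) * Real.exp (a * t + v * t ^ 2 / 2))
      ((X * p + C v * derivative p).eval (a + v * t) * Real.exp (a * t + v * t ^ 2 / 2)) t := by
  have hlin : HasDerivAt (fun t => a + v * t) v t := by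
    simpa using ((hasDerivAt_id t).const_mul v).const_add a
  have hquad : HasDerivAt (fun t => a * t + v * t ^ 2 / 2) (a + v * t) t := by
    refine (((hasDerivAt_id t).const_mul a).add
      (((hasDerivAt_pow 2 t).const_mul v).div_const 2)).congr_deriv ?_
    simp only [mul_one, Nat.cast_ofNat, Nat.add_one_sub_one, pow_one, add_right_inj]
    ring
  refine (((p.hasDerivAt _).comp t hlin).mul hquad.exp).congr_deriv ?_
  simp only [eval_add, eval_mul, eval_X, eval_C, Function.comp_apply]
  ring

-- The iterated operator is the action of `d/dt` on the factor `p` of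
-- `p (a + v t) exp (a t + v t² / 2)`, which is the moment generating function for `p = 1`.
lemma integral_pow_gaussianReal (a : ℝ) (v : NNReal) (n : ℕ) :
    ∫ x, x ^ n ∂gaussianReal a v =
      ((fun p : ℝ[X] => X * p + C (v : ℝ) * derivative p)^[n] 1).eval a := by
  have hderiv : ∀ n : ℕ, iteratedDeriv n (mgf id (gaussianReal a v)) = fun t =>
      ((fun p : ℝ[X] => X * p + C (v : ℝ) * derivative p)^[n] 1).eval (a + v * t) *
        Real.exp (a * t + v * t ^ 2 / 2) := fun n => by
    induction n with
    | zero => simp [mgf_id_gaussianReal]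
    | succ n ih =>
      rw [iteratedDeriv_succ, ih, Function.iterate_succ_apply']
      exact funext fun t => (hasDerivAt_eval_mul_exp a v _ t).deriv
  have hmem : 0 ∈ interior (integrableExpSet id (gaussianReal a v)) := by simp
  have hzero := iteratedDeriv_mgf_zero hmem n
  rw [hderiv] at hzero
  simpa using hzero.symm

lemma integral_sq_gaussianReal (a : ℝ) (v : NNReal) :
    ∫ x, x ^ 2 ∂gaussianReal a v = a ^ 2 + v := by
  rw [integral_pow_gaussianReal, Function.iterate_succ_apply, Function.iterate_succ_apply,
    Function.iterate_zero_apply]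
  simp [sq]

lemma integral_pow_four_gaussianReal (a : ℝ) (v : NNReal) :
    ∫ x, x ^ 4 ∂gaussianReal a v = a ^ 4 + 6 * a ^ 2 * v + 3 * v ^ 2 := by
  rw [integral_pow_gaussianReal, Function.iterate_succ_apply, Function.iterate_succ_apply,
    Function.iterate_succ_apply, Function.iterate_succ_apply, Function.iterate_zero_apply]
  simp only [mul_one, derivative_one, mul_zero, add_zero, derivative_X, derivative_add,
    derivative_mul, one_mul, derivative_C, zero_mul, zero_add, eval_add, eval_mul, eval_X, eval_C,
    eval_one]
  ring

lemma memLp_sq_gaussianReal (a : ℝ) (v : NNReal) :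
    MemLp (fun x : ℝ => x ^ 2) 2 (gaussianReal a v) := by
  have hint := (memLp_id_gaussianReal (μ := a) (v := v) (4 : ℕ)).integrable_norm_pow (by norm_num)
  rw [memLp_two_iff_integrable_sq (by fun_prop)]
  simpa [← pow_mul, Even.pow_abs (by decide : Even 4)] using hint

lemma variance_sq_gaussianReal (a : ℝ) (v : NNReal) :
    Var[fun x => x ^ 2; gaussianReal a v] = 2 * v ^ 2 + 4 * a ^ 2 * v := by
  have hpow : ∀ x : ℝ, (x ^ 2) ^ 2 = x ^ 4 := fun x => by ring
  rw [variance_eq_sub (memLp_sq_gaussianReal a v), integral_sq_gaussianReal]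
  simp only [Pi.pow_apply, hpow, integral_pow_four_gaussianReal]
  ring

end GaussianMoments

section SumTests

variable {d : ℕ} {σ ε : ℝ}

lemma integral_sum_obsLaw {f : ℝ → ℝ} {θ : Fin d → ℝ}
    (hf : ∀ j, Integrable f (gaussianReal (θ j) (σ ^ 2).toNNReal)) :
    ∫ y, ∑ j, f (y j) ∂obsLaw d σ θ = ∑ j, ∫ x, f x ∂gaussianReal (θ j) (σ ^ 2).toNNReal :=
  integral_sum_pi hf

lemma variance_sum_obsLaw {f : ℝ → ℝ} {θ : Fin d → ℝ}
    (hf : ∀ j, MemLp f 2 (gaussianReal (θ j) (σ ^ 2).toNNReal)) :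
    Var[fun y => ∑ j, f (y j); obsLaw d σ θ] =
      ∑ j, Var[f; gaussianReal (θ j) (σ ^ 2).toNNReal] := by
  rw [← variance_sum_pi hf]
  congr 1
  ext y
  simp only [Finset.sum_apply]

lemma minimaxTestRisk_le_of_sum {Θ : Set (Fin d → ℝ)} {f : ℝ → ℝ} {T : ℝ} (hε : 0 ≤ ε)
    (hf : Measurable f) (hLp : ∀ a, MemLp f 2 (gaussianReal a (σ ^ 2).toNNReal))
    (h0 : d * ∫ x, f x ∂gaussianReal 0 (σ ^ 2).toNNReal < T)
    (hvar0 : d * Var[f; gaussianReal 0 (σ ^ 2).toNNReal] ≤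
      ε / 2 * (T - d * ∫ x, f x ∂gaussianReal 0 (σ ^ 2).toNNReal) ^ 2)
    (h1 : ∀ θ ∈ Θ, T < ∑ j, ∫ x, f x ∂gaussianReal (θ j) (σ ^ 2).toNNReal)
    (hvar1 : ∀ θ ∈ Θ, ∑ j, Var[f; gaussianReal (θ j) (σ ^ 2).toNNReal] ≤
      ε / 2 * ((∑ j, ∫ x, f x ∂gaussianReal (θ j) (σ ^ 2).toNNReal) - T) ^ 2) :
    minimaxTestRisk d σ Θ ≤ ENNReal.ofReal ε := by
  have hmean : ∀ θ : Fin d → ℝ, ∫ y, ∑ j, f (y j) ∂obsLaw d σ θ =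
      ∑ j, ∫ x, f x ∂gaussianReal (θ j) (σ ^ 2).toNNReal := fun θ =>
    integral_sum_obsLaw fun j => (hLp (θ j)).integrable one_le_two
  have hvar : ∀ θ : Fin d → ℝ, Var[fun y => ∑ j, f (y j); obsLaw d σ θ] =
      ∑ j, Var[f; gaussianReal (θ j) (σ ^ 2).toNNReal] := fun θ =>
    variance_sum_obsLaw fun j => hLp (θ j)
  refine minimaxTestRisk_le_of_variance_le (S := fun y => ∑ j, f (y j)) (T := T)
    (Finset.univ.measurable_fun_sum fun j _ => hf.comp (measurable_pi_apply j)) hε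
    (fun θ => memLp_sum_pi fun j => hLp (θ j)) ?_ ?_ fun θ hθ => ?_
  · simpa [hmean] using h0
  · simpa [hmean, hvar] using hvar0
  · rw [hmean, hvar]
    exact ⟨h1 θ hθ, hvar1 θ hθ⟩

lemma sum_ite_ne_zero_const (θ : Fin d → ℝ) (c : ℝ) :
    ∑ j, (if θ j ≠ 0 then c else 0) = numNonzero θ * c := by
  rw [← Finset.sum_filter, Finset.sum_const, nsmul_eq_mul, numNonzero]

end SumTests

section CountingTest

lemma variance_indicator_one {Ω : Type*} [MeasurableSpace Ω] {P : Measure Ω}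
    [IsProbabilityMeasure P] {B : Set Ω} (hB : MeasurableSet B) :
    Var[B.indicator 1; P] = P.real B * P.real Bᶜ := by
  have hLp : MemLp (B.indicator (1 : Ω → ℝ)) 2 P := (memLp_const 1).indicator hB
  have hsq : (B.indicator 1 : Ω → ℝ) ^ 2 = B.indicator 1 := by
    ext ω
    by_cases hω : ω ∈ B <;> simp [hω]
  rw [variance_eq_sub hLp, hsq, integral_indicator_one hB, probReal_compl_eq_one_sub hB]
  ring

variable {d s : ℕ} {σ ε δ : ℝ}

lemma add_div_two_le_sum_measureReal {p : ℝ → Measure ℝ} {B : Set ℝ} {θ : Fin d → ℝ}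
    (hθ : θ ∈ thetaStarClass d s δ) (h : ∀ a, δ ≤ |a| → (p 0).real B + 1 / 2 ≤ (p a).real B) :
    d * (p 0).real B + s / 2 ≤ ∑ j, (p (θ j)).real B := by
  have hcoord : ∀ j, (p 0).real B + (if θ j ≠ 0 then 1 / 2 else 0) ≤ (p (θ j)).real B :=
    fun j => by
      split_ifs with hj
      · exact h _ (hθ.2 j hj)
      · rw [not_not.1 hj, add_zero]
  calc d * (p 0).real B + s / 2
      = ∑ j, ((p 0).real B + (if θ j ≠ 0 then 1 / 2 else 0)) := by
        rw [Finset.sum_add_distrib, sum_ite_ne_zero_const, hθ.1, Finset.sum_const,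
          Finset.card_fin, nsmul_eq_mul, mul_one_div]
    _ ≤ ∑ j, (p (θ j)).real B := Finset.sum_le_sum fun j _ => hcoord j

lemma minimaxTestRisk_thetaStarClass_le_of_count {B : Set ℝ} {q : ℝ} (hs : 1 ≤ s) (hε : 0 ≤ ε)
    (hB : MeasurableSet B) (h0 : (gaussianReal 0 (σ ^ 2).toNNReal).real B ≤ q)
    (h1 : ∀ a, δ ≤ |a| → (gaussianReal a (σ ^ 2).toNNReal).real Bᶜ ≤ q) (hq : q ≤ 1 / 4)
    (hdq : 32 * (d * q) ≤ ε * s ^ 2) :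
    minimaxTestRisk d σ (thetaStarClass d s δ) ≤ ENNReal.ofReal ε := by
  let P : ℝ → Measure ℝ := fun a => gaussianReal a (σ ^ 2).toNNReal
  have hs0 : (0 : ℝ) < s := Nat.cast_pos.2 hs
  have hmean : ∀ a, ∫ x, B.indicator 1 x ∂P a = (P a).real B := fun a => integral_indicator_one hB
  have hvar0 : Var[B.indicator 1; P 0] ≤ q := by
    rw [variance_indicator_one hB]
    exact (mul_le_of_le_one_right measureReal_nonneg measureReal_le_one).trans h0
  have hvar : ∀ θ ∈ thetaStarClass d s δ, ∀ j, Var[B.indicator 1; P (θ j)] ≤ q := by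
    intro θ hθ j
    by_cases hj : θ j = 0
    · rwa [hj]
    · rw [variance_indicator_one hB]
      exact (mul_le_of_le_one_left measureReal_nonneg measureReal_le_one).trans (h1 _ (hθ.2 j hj))
  have hgain : ∀ θ ∈ thetaStarClass d s δ, d * (P 0).real B + s / 2 ≤ ∑ j, (P (θ j)).real B :=
    fun θ hθ => add_div_two_le_sum_measureReal hθ fun a ha => by
      have hcompl := h1 a ha
      rw [probReal_compl_eq_one_sub hB] at hcompl
      linarith
  have hbound : d * q ≤ ε / 2 * (s / 4) ^ 2 := by linarith
  refine minimaxTestRisk_le_of_sum (T := d * (P 0).real B + s / 4) hε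
    (measurable_one.indicator hB) (fun a => (memLp_const 1).indicator hB) ?_ ?_
    (fun θ hθ => ?_) fun θ hθ => ?_
  · exact (congrArg ((d : ℝ) * ·) (hmean 0)).trans_lt (lt_add_of_pos_right _ (by positivity))
  · refine (mul_le_mul_of_nonneg_left hvar0 d.cast_nonneg).trans (hbound.trans_eq ?_)
    rw [hmean, add_sub_cancel_left]
  · rw [Finset.sum_congr rfl fun j _ => hmean (θ j)]
    linarith [hgain θ hθ]
  · rw [Finset.sum_congr rfl fun j _ => hmean (θ j)]
    calc ∑ j, Var[B.indicator 1; P (θ j)] ≤ ∑ _j : Fin d, q :=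
          Finset.sum_le_sum fun j _ => hvar θ hθ j
      _ = d * q := by simp
      _ ≤ ε / 2 * (s / 4) ^ 2 := hbound
      _ ≤ _ := by
        gcongr
        linarith [hgain θ hθ]

lemma gaussianReal_abs_ge_le (v : NNReal) {t : ℝ} (ht : 0 ≤ t) :
    (gaussianReal 0 v).real {x | t ≤ |x|} ≤ 2 * Real.exp (-t ^ 2 / (2 * v)) := by
  have hsub : HasSubgaussianMGF (fun x => x) v (gaussianReal 0 v) :=
    ⟨fun u => integrable_exp_mul_gaussianReal u, fun u => by simp [mgf_fun_id_gaussianReal]⟩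
  have hunion : {x : ℝ | t ≤ |x|} ⊆ {x | t ≤ x} ∪ {x | t ≤ (-fun x => x) x} := fun x hx =>
    le_abs.1 (show t ≤ |x| from hx)
  calc (gaussianReal 0 v).real {x | t ≤ |x|}
      ≤ (gaussianReal 0 v).real {x | t ≤ x} + (gaussianReal 0 v).real {x | t ≤ (-fun x => x) x} :=
        (measureReal_mono hunion).trans (measureReal_union_le _ _)
    _ ≤ 2 * Real.exp (-t ^ 2 / (2 * v)) := by
        linarith [hsub.measure_ge_le ht, hsub.neg.measure_ge_le ht]

lemma gaussianReal_abs_lt_le (v : NNReal) {a t : ℝ} (ha : 2 * t ≤ |a|) :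
    (gaussianReal a v).real {x | |x| < t} ≤ (gaussianReal 0 v).real {x | t ≤ |x|} := by
  have hmap : gaussianReal a v = (gaussianReal 0 v).map (a + ·) := by
    rw [gaussianReal_map_const_add, zero_add]
  rw [hmap, map_measureReal_apply (by fun_prop) (measurableSet_lt (by fun_prop) measurable_const)]
  refine measureReal_mono fun x (hx : |a + x| < t) => show t ≤ |x| from ?_
  have htri : |a| ≤ |a + x| + |x| := by simpa using abs_sub (a + x) x
  linarith

lemma minimaxTestRisk_thetaStarClass_le_of_exp {q : ℝ} (hs : 1 ≤ s) (hε : 0 ≤ ε) (hδ : 0 ≤ δ)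
    (hexp : 2 * Real.exp (-(δ ^ 2 / (8 * σ ^ 2))) ≤ q) (hq : q ≤ 1 / 4)
    (hdq : 32 * (d * q) ≤ ε * s ^ 2) :
    minimaxTestRisk d σ (thetaStarClass d s δ) ≤ ENNReal.ofReal ε := by
  have htail : (gaussianReal 0 (σ ^ 2).toNNReal).real {x | δ / 2 ≤ |x|} ≤ q := by
    refine ((gaussianReal_abs_ge_le _ (by positivity)).trans_eq ?_).trans hexp
    rw [Real.coe_toNNReal _ (sq_nonneg σ)]
    ring_nf
  have hcompl : {x : ℝ | δ / 2 ≤ |x|}ᶜ = {x | |x| < δ / 2} := by ext x; simp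
  refine minimaxTestRisk_thetaStarClass_le_of_count hs hε
    (measurableSet_le measurable_const (by fun_prop)) htail (fun a ha => ?_) hq hdq
  rw [hcompl]
  exact (gaussianReal_abs_lt_le _ (by linarith)).trans htail

end CountingTest

section ChiSquareTest

lemma mul_two_mul_sq_le {n : ℕ} {τ ε ρ : ℝ} (hτ : 0 ≤ τ) (hε : 0 ≤ ε) (hε1 : ε ≤ 1)
    (h : 64 * (τ * √n) ≤ ε * ρ) : n * (2 * τ ^ 2) ≤ ε / 16 * ρ ^ 2 :=
  calc n * (2 * τ ^ 2) = 2 * (τ * √n) ^ 2 := by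
        rw [mul_pow, Real.sq_sqrt n.cast_nonneg]
        ring
    _ ≤ (64 * (τ * √n)) ^ 2 / 16 := by nlinarith [sq_nonneg (τ * √n)]
    _ ≤ (ε * ρ) ^ 2 / 16 := by gcongr
    _ = ε * ε / 16 * ρ ^ 2 := by ring
    _ ≤ ε / 16 * ρ ^ 2 := by
        gcongr
        exact mul_le_of_le_one_right hε hε1

lemma mul_two_mul_sq_add_le {n : ℕ} {τ ε ρ μ : ℝ} (hn : 1 ≤ n) (hτ : 0 ≤ τ) (hε : 0 ≤ ε)
    (hε1 : ε ≤ 1) (h : 64 * (τ * √n) ≤ ε * ρ) (hρ : 0 ≤ ρ) (hμ : ρ ≤ μ) :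
    n * (2 * τ ^ 2) + 4 * μ * τ ≤ ε / 2 * (μ - ρ / 2) ^ 2 := by
  have hn1 : 1 ≤ √(n : ℝ) := Real.one_le_sqrt.2 (mod_cast hn)
  have hμ0 : 0 ≤ μ := hρ.trans hμ
  have hτμ : 64 * τ ≤ ε * μ :=
    calc 64 * τ ≤ 64 * (τ * √n) := by
          gcongr
          exact le_mul_of_one_le_right hτ hn1
      _ ≤ ε * ρ := h
      _ ≤ ε * μ := by gcongr
  calc n * (2 * τ ^ 2) + 4 * μ * τ = n * (2 * τ ^ 2) + μ * (64 * τ) / 16 := by ring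
    _ ≤ ε / 16 * ρ ^ 2 + μ * (ε * μ) / 16 := by
        have hnoise := mul_two_mul_sq_le hτ hε hε1 h
        gcongr
    _ ≤ ε / 16 * μ ^ 2 + μ * (ε * μ) / 16 := by gcongr
    _ = ε / 2 * (μ / 2) ^ 2 := by ring
    _ ≤ ε / 2 * (μ - ρ / 2) ^ 2 := by
        gcongr
        linarith

variable {d s : ℕ} {σ ε ρ δ : ℝ}

lemma minimaxTestRisk_le_of_sum_sq {Θ : Set (Fin d → ℝ)} (hd : 1 ≤ d) (hσ : σ ≠ 0) (hε : 0 < ε)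
    (hε1 : ε ≤ 1) (hρ : 64 * (σ ^ 2 * √d) ≤ ε * ρ) (hΘ : ∀ θ ∈ Θ, ρ ≤ ∑ j, θ j ^ 2) :
    minimaxTestRisk d σ Θ ≤ ENNReal.ofReal ε := by
  have hσ2 : 0 ≤ σ ^ 2 := sq_nonneg σ
  have hmean : ∀ a, ∫ x, x ^ 2 ∂gaussianReal a (σ ^ 2).toNNReal = a ^ 2 + σ ^ 2 := fun a => by
    rw [integral_sq_gaussianReal, Real.coe_toNNReal _ hσ2]
  have hvar : ∀ a, Var[fun x => x ^ 2; gaussianReal a (σ ^ 2).toNNReal] =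
      2 * (σ ^ 2) ^ 2 + 4 * a ^ 2 * σ ^ 2 := fun a => by
    rw [variance_sq_gaussianReal, Real.coe_toNNReal _ hσ2]
  have hρ0 : 0 < ρ := pos_of_mul_pos_right (lt_of_lt_of_le (by positivity) hρ) hε.le
  have hsq : 0 ≤ ε * ρ ^ 2 := by positivity
  refine minimaxTestRisk_le_of_sum (f := fun x => x ^ 2) (T := d * σ ^ 2 + ρ / 2) hε.le
    (by fun_prop) (fun a => memLp_sq_gaussianReal a _) ?_ ?_ (fun θ hθ => ?_) fun θ hθ => ?_
  · rw [hmean]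
    linarith
  · rw [hmean, hvar]
    linarith [mul_two_mul_sq_le hσ2 hε.le hε1 hρ]
  · simp only [hmean, Finset.sum_add_distrib, Finset.sum_const, Finset.card_fin, nsmul_eq_mul]
    linarith [hΘ θ hθ]
  · simp only [hmean, hvar, Finset.sum_add_distrib, Finset.sum_const, Finset.card_fin,
      nsmul_eq_mul, ← Finset.sum_mul, ← Finset.mul_sum, add_comm _ (d * σ ^ 2),
      add_sub_add_left_eq_sub]
    exact mul_two_mul_sq_add_le hd hσ2 hε.le hε1 hρ hρ0.le (hΘ θ hθ)

lemma mul_sq_le_sum_sq {θ : Fin d → ℝ} (hδ : 0 ≤ δ) (hθ : θ ∈ thetaStarClass d s δ) :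
    s * δ ^ 2 ≤ ∑ j, θ j ^ 2 := by
  have hcoord : ∀ j, (if θ j ≠ 0 then δ ^ 2 else 0) ≤ θ j ^ 2 := fun j => by
    split_ifs with hj
    · rw [← sq_abs (θ j)]
      gcongr
      exact hθ.2 j hj
    · positivity
  calc s * δ ^ 2 = ∑ j, (if θ j ≠ 0 then δ ^ 2 else 0) := by
        rw [sum_ite_ne_zero_const, hθ.1]
    _ ≤ ∑ j, θ j ^ 2 := Finset.sum_le_sum fun j _ => hcoord j

lemma minimaxTestRisk_thetaStarClass_le_of_sum_sq (hd : 1 ≤ d) (hσ : σ ≠ 0) (hε : 0 < ε)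
    (hε1 : ε ≤ 1) (hδ : 0 ≤ δ) (hle : 64 * (σ ^ 2 * √d) ≤ ε * (s * δ ^ 2)) :
    minimaxTestRisk d σ (thetaStarClass d s δ) ≤ ENNReal.ofReal ε :=
  minimaxTestRisk_le_of_sum_sq hd hσ hε hε1 hle fun _ hθ => mul_sq_le_sum_sq hδ hθ

end ChiSquareTest

section Rates

/-- The minimax rate `σ √(log (1 + d / s²))` in the sparse regime `s ≤ √d`. -/
noncomputable def sparseRate (d s : ℕ) (σ : ℝ) : ℝ := σ * √(Real.log (1 + d / s ^ 2))

/-- The minimax rate `σ d^(1/4) / √s` in the dense regime `√d ≤ s`. -/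
noncomputable def denseRate (d s : ℕ) (σ : ℝ) : ℝ := σ * d ^ ((1 : ℝ) / 4) / √s

variable {d s : ℕ} {σ : ℝ}

lemma sparseRate_pos (hs : 1 ≤ s) (hsd : s ≤ d) (hσ : 0 < σ) : 0 < sparseRate d s σ := by
  have : (0 : ℝ) < s := Nat.cast_pos.2 hs
  have hd0 : (0 : ℝ) < d := Nat.cast_pos.2 (hs.trans hsd)
  have hlog : 0 < Real.log (1 + d / s ^ 2) := Real.log_pos (lt_add_of_pos_right 1 (by positivity))
  unfold sparseRate
  positivity

lemma denseRate_pos (hs : 1 ≤ s) (hsd : s ≤ d) (hσ : 0 < σ) : 0 < denseRate d s σ := by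
  have : (0 : ℝ) < s := Nat.cast_pos.2 hs
  have hd0 : (0 : ℝ) < d := Nat.cast_pos.2 (hs.trans hsd)
  unfold denseRate
  positivity

lemma mul_sparseRate_sq (d s : ℕ) (σ A : ℝ) :
    (A * sparseRate d s σ) ^ 2 = σ ^ 2 * (A ^ 2 * Real.log (1 + d / s ^ 2)) := by
  have hlog : 0 ≤ Real.log (1 + d / s ^ 2) :=
    Real.log_nonneg (le_add_of_nonneg_right (by positivity))
  rw [sparseRate, mul_pow, mul_pow, Real.sq_sqrt hlog, mul_left_comm]

lemma mul_denseRate_sq (d s : ℕ) (σ A : ℝ) :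
    (A * denseRate d s σ) ^ 2 = σ ^ 2 * (A ^ 2 * (√d / s)) := by
  have hroot : ((d : ℝ) ^ ((1 : ℝ) / 4)) ^ 2 = √d := by
    rw [Real.sqrt_eq_rpow, ← Real.rpow_mul_natCast d.cast_nonneg]
    norm_num
  rw [denseRate, mul_pow, div_pow, mul_pow, hroot, Real.sq_sqrt s.cast_nonneg]
  ring

lemma exists_pos_forall_le_sq (c : ℝ) : ∃ A₀ : ℝ, 0 < A₀ ∧ ∀ A, A₀ < A → c ≤ A ^ 2 :=
  ⟨|c| + 1, by positivity, fun A hA => by nlinarith [le_abs_self c, abs_nonneg c]⟩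

lemma exists_pos_forall_sq_le {c : ℝ} (hc : 0 < c) :
    ∃ a₀ : ℝ, 0 < a₀ ∧ ∀ A, 0 < A → A < a₀ → A ^ 2 ≤ 1 ∧ 2 * A ^ 2 ≤ c := by
  refine ⟨√(min 1 (c / 2)), by positivity, fun A hA hA₀ => ?_⟩
  have hsq := ((Real.lt_sqrt hA.le).1 hA₀).le
  exact ⟨hsq.trans (min_le_left _ _), by linarith [hsq.trans (min_le_right _ _)]⟩

end Rates

section SparseRegime

variable {d s : ℕ} {σ ε A : ℝ}

lemma le_minimaxTestRisk_thetaClass_sparseRate (hs : 1 ≤ s) (hsd : s ≤ d) (hσ : 0 < σ)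
    (hε : 0 ≤ ε) (hA : 0 < A) (hA1 : A ^ 2 ≤ 1) (hAε : 2 * A ^ 2 ≤ Real.log (1 + ε ^ 2)) :
    ENNReal.ofReal (1 - ε) ≤ minimaxTestRisk d σ (thetaClass d s (A * sparseRate d s σ)) := by
  have : (0 : ℝ) < s := Nat.cast_pos.2 hs
  refine le_minimaxTestRisk_thetaClass hs hsd hσ.ne' hε
    (mul_pos hA (sparseRate_pos hs hsd hσ)).ne' ?_
  rw [mul_sparseRate_sq, mul_div_cancel_left₀ _ (by positivity)]
  have hr : 0 ≤ (d : ℝ) / s ^ 2 := by positivity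
  have hbernoulli : Real.exp (A ^ 2 * Real.log (1 + d / s ^ 2)) ≤ 1 + A ^ 2 * (d / s ^ 2) := by
    rw [mul_comm, ← Real.rpow_def_of_pos (by positivity)]
    exact rpow_one_add_le_one_add_mul_self (by linarith) (sq_nonneg A) hA1
  calc 2 * (s : ℝ) ^ 2 * (Real.exp (A ^ 2 * Real.log (1 + d / s ^ 2)) - 1)
      ≤ 2 * s ^ 2 * (A ^ 2 * (d / s ^ 2)) := by
        gcongr
        linarith
    _ = d * (2 * A ^ 2) := by field_simp
    _ ≤ d * Real.log (1 + ε ^ 2) := by gcongr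

lemma mul_two_mul_exp_neg_mul_log_le {r c : ℝ} (hr : 1 ≤ r) (hε : 0 < ε) (hc : 1 + 128 / ε ≤ c) :
    r * (2 * Real.exp (-(c * Real.log (1 + r)))) ≤ ε / 32 := by
  have hr1 : 0 < 1 + r := by linarith
  have hlog : 1 / 2 ≤ Real.log (1 + r) := by
    have hlog2 : Real.log 2 ≤ Real.log (1 + r) := Real.log_le_log two_pos (by linarith)
    linarith [Real.log_two_gt_d9]
  have hexponent : 64 / ε ≤ (c - 1) * Real.log (1 + r) :=
    calc 64 / ε = 128 / ε * (1 / 2) := by ring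
      _ ≤ (c - 1) * Real.log (1 + r) := by
        have hc0 : 0 ≤ 128 / ε := by positivity
        gcongr <;> linarith
  have hexp : Real.exp (-(64 / ε)) ≤ ε / 64 := by
    rw [Real.exp_neg, inv_le_comm₀ (Real.exp_pos _) (by positivity), inv_div]
    linarith [Real.add_one_le_exp (64 / ε)]
  calc r * (2 * Real.exp (-(c * Real.log (1 + r))))
      ≤ (1 + r) * (2 * Real.exp (-(c * Real.log (1 + r)))) := by
        gcongr
        linarith
    _ = 2 * Real.exp (-((c - 1) * Real.log (1 + r))) := by
        nth_rewrite 1 [← Real.exp_log hr1]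
        rw [mul_left_comm, ← Real.exp_add]
        ring_nf
    _ ≤ 2 * Real.exp (-(64 / ε)) := by gcongr
    _ ≤ ε / 32 := by linarith

lemma minimaxTestRisk_thetaStarClass_sparseRate_le (hs : 1 ≤ s) (hsd : (s : ℝ) ≤ √d) (hσ : 0 < σ)
    (hε : 0 < ε) (hε1 : ε ≤ 1) (hA : 0 ≤ A) (hAε : 8 * (1 + 128 / ε) ≤ A ^ 2) :
    minimaxTestRisk d σ (thetaStarClass d s (A * sparseRate d s σ)) ≤ ENNReal.ofReal ε := by
  have hs0 : (0 : ℝ) < s := Nat.cast_pos.2 hs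
  have hr : 1 ≤ (d : ℝ) / s ^ 2 := (one_le_div (by positivity)).2 ((Real.le_sqrt' hs0).1 hsd)
  have hδ : 0 ≤ A * sparseRate d s σ := by
    unfold sparseRate
    positivity
  set q := 2 * Real.exp (-(A ^ 2 / 8 * Real.log (1 + d / s ^ 2)))
  have hq0 : 0 ≤ q := by positivity
  have hrq : d / s ^ 2 * q ≤ ε / 32 := mul_two_mul_exp_neg_mul_log_le hr hε (by linarith)
  refine minimaxTestRisk_thetaStarClass_le_of_exp (q := q) hs hε.le hδ (le_of_eq ?_) ?_ ?_
  · rw [mul_sparseRate_sq, mul_comm 8, mul_div_mul_left _ _ (by positivity), mul_div_right_comm]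
  · linarith [le_mul_of_one_le_left hq0 hr]
  · calc 32 * (d * q) = 32 * (d / s ^ 2 * q) * s ^ 2 := by field_simp
      _ ≤ ε * s ^ 2 := by
        gcongr
        linarith

end SparseRegime

section DenseRegime

variable {d s : ℕ} {σ ε A : ℝ}

lemma cosh_le_one_add_sq {x : ℝ} (hx : |x| ≤ 1) : Real.cosh x ≤ 1 + x ^ 2 := by
  have hx2 : x ^ 2 ≤ 1 := (sq_le_one_iff_abs_le_one x).2 hx
  have hhalf : |x ^ 2 / 2| = x ^ 2 / 2 := abs_of_nonneg (by positivity)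
  have hexp := (abs_le.1 (Real.abs_exp_sub_one_le (x := x ^ 2 / 2) (by linarith))).2
  linarith [Real.cosh_le_exp_half_sq x]

lemma le_minimaxTestRisk_thetaStarClass_denseRate (hs : 1 ≤ s) (hsd : s ≤ d) (hds : √d ≤ s)
    (hσ : 0 < σ) (hε : 0 ≤ ε) (hA : 0 < A) (hA1 : A ^ 2 ≤ 1)
    (hAε : 2 * A ^ 2 ≤ Real.log (1 + ε ^ 2)) :
    ENNReal.ofReal (1 - ε) ≤ minimaxTestRisk d σ (thetaStarClass d s (A * denseRate d s σ)) := by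
  have hs0 : (0 : ℝ) < s := Nat.cast_pos.2 hs
  refine le_minimaxTestRisk_thetaStarClass hs hsd hσ.ne' hε
    (mul_pos hA (denseRate_pos hs hsd hσ)) ?_
  rw [mul_denseRate_sq, mul_div_cancel_left₀ _ (by positivity)]
  have habs : |A ^ 2 * (√d / s)| ≤ 1 := by
    rw [abs_of_nonneg (by positivity)]
    exact mul_le_one₀ hA1 (by positivity) ((div_le_one hs0).2 hds)
  calc 2 * (s : ℝ) ^ 2 * (Real.cosh (A ^ 2 * (√d / s)) - 1)
      ≤ 2 * s ^ 2 * (A ^ 2 * (√d / s)) ^ 2 := by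
        gcongr
        linarith [cosh_le_one_add_sq habs]
    _ = d * (2 * (A ^ 2 * A ^ 2)) := by
        rw [mul_pow, div_pow, Real.sq_sqrt d.cast_nonneg]
        field_simp
    _ ≤ d * (2 * (1 * A ^ 2)) := by gcongr
    _ ≤ d * Real.log (1 + ε ^ 2) := by
        rw [one_mul]
        gcongr

lemma minimaxTestRisk_thetaStarClass_denseRate_le (hs : 1 ≤ s) (hsd : s ≤ d) (hσ : 0 < σ)
    (hε : 0 < ε) (hε1 : ε ≤ 1) (hA : 0 ≤ A) (hAε : 64 / ε ≤ A ^ 2) :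
    minimaxTestRisk d σ (thetaStarClass d s (A * denseRate d s σ)) ≤ ENNReal.ofReal ε := by
  have : (0 : ℝ) < s := Nat.cast_pos.2 hs
  refine minimaxTestRisk_thetaStarClass_le_of_sum_sq (hs.trans hsd) hσ.ne' hε hε1
    (mul_nonneg hA (denseRate_pos hs hsd hσ).le) ?_
  calc 64 * (σ ^ 2 * √d) ≤ A ^ 2 * ε * (σ ^ 2 * √d) := by
        gcongr
        exact (div_le_iff₀ hε).1 hAε
    _ = ε * (s * (A * denseRate d s σ) ^ 2) := by
        rw [mul_denseRate_sq]
        field_simp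

end DenseRegime

section TestingRates

variable {R R' : ℕ → ℕ → Prop} {Θ : (d s : ℕ) → ℝ → Set (Fin d → ℝ)}
  {rate rate' : ℕ → ℕ → ℝ → ℝ}

lemma IsMinimaxTestingRate.mono (h : IsMinimaxTestingRate R Θ rate)
    (hR : ∀ d s, R' d s → R d s) : IsMinimaxTestingRate R' Θ rate := by
  obtain ⟨hpos, hupper, hlower⟩ := h
  refine ⟨fun d s σ hds => hpos d s σ (hR d s hds), fun ε hε hε1 => ?_, fun ε hε hε1 => ?_⟩
  · exact (hupper ε hε hε1).imp fun A₀ hA₀ => ⟨hA₀.1, fun d s σ hds => hA₀.2 d s σ (hR d s hds)⟩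
  · exact (hlower ε hε hε1).imp fun a₀ ha₀ => ⟨ha₀.1, fun d s σ hds => ha₀.2 d s σ (hR d s hds)⟩

lemma IsMinimaxTestingRate.ite {p : ℕ → ℕ → Prop} [∀ d s, Decidable (p d s)]
    (h : IsMinimaxTestingRate (fun d s => R d s ∧ p d s) Θ rate)
    (h' : IsMinimaxTestingRate (fun d s => R d s ∧ ¬p d s) Θ rate') :
    IsMinimaxTestingRate R Θ fun d s σ => if p d s then rate d s σ else rate' d s σ := by
  obtain ⟨hpos, hupper, hlower⟩ := h
  obtain ⟨hpos', hupper', hlower'⟩ := h'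
  refine ⟨fun d s σ hds hσ => ?_, fun ε hε hε1 => ?_, fun ε hε hε1 => ?_⟩
  · dsimp only
    split_ifs with hp
    exacts [hpos d s σ ⟨hds, hp⟩ hσ, hpos' d s σ ⟨hds, hp⟩ hσ]
  · obtain ⟨A₀, hA₀, hle⟩ := hupper ε hε hε1
    obtain ⟨A₀', -, hle'⟩ := hupper' ε hε hε1
    refine ⟨max A₀ A₀', lt_max_of_lt_left hA₀, fun d s σ hds hσ A hA => ?_⟩
    obtain ⟨hA, hA'⟩ := max_lt_iff.1 hA
    dsimp only
    split_ifs with hp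
    exacts [hle d s σ ⟨hds, hp⟩ hσ A hA, hle' d s σ ⟨hds, hp⟩ hσ A hA']
  · obtain ⟨a₀, ha₀, hle⟩ := hlower ε hε hε1
    obtain ⟨a₀', ha₀', hle'⟩ := hlower' ε hε hε1
    refine ⟨min a₀ a₀', lt_min ha₀ ha₀', fun d s σ hds hσ A hA0 hA => ?_⟩
    obtain ⟨hA, hA'⟩ := lt_min_iff.1 hA
    dsimp only
    split_ifs with hp
    exacts [hle d s σ ⟨hds, hp⟩ hσ A hA0 hA, hle' d s σ ⟨hds, hp⟩ hσ A hA0 hA']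

lemma thetaClass_subset_thetaStarClass (d s : ℕ) {δ : ℝ} (hδ : 0 ≤ δ) :
    thetaClass d s δ ⊆ thetaStarClass d s δ := fun θ hθ => ⟨hθ.1, fun j hj => by
  rw [(hθ.2 j).resolve_left hj, abs_of_nonneg hδ]⟩

lemma log_one_add_sq_pos {ε : ℝ} (hε : 0 < ε) : 0 < Real.log (1 + ε ^ 2) :=
  Real.log_pos (lt_add_of_pos_right 1 (by positivity))

theorem isMinimaxTestingRate_sparseRate
    (hlower : ∀ d s δ, 0 < δ → thetaClass d s δ ⊆ Θ d s δ)
    (hupper : ∀ d s δ, 0 < δ → Θ d s δ ⊆ thetaStarClass d s δ) :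
    IsMinimaxTestingRate (fun d s => 1 ≤ s ∧ s ≤ d ∧ (s : ℝ) ≤ √d) Θ sparseRate := by
  refine ⟨fun d s σ h hσ => sparseRate_pos h.1 h.2.1 hσ, fun ε hε hε1 => ?_, fun ε hε _ => ?_⟩
  · obtain ⟨A₀, hA₀, hsq⟩ := exists_pos_forall_le_sq (8 * (1 + 128 / ε))
    refine ⟨A₀, hA₀, fun d s σ ⟨hs, hsd, hds⟩ hσ A hA => ?_⟩
    have hA0 : 0 < A := hA₀.trans hA
    exact (minimaxTestRisk_mono (hupper d s _ (mul_pos hA0 (sparseRate_pos hs hsd hσ)))).trans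
      (minimaxTestRisk_thetaStarClass_sparseRate_le hs hds hσ hε hε1.le hA0.le (hsq A hA))
  · obtain ⟨a₀, ha₀, hsq⟩ := exists_pos_forall_sq_le (log_one_add_sq_pos hε)
    refine ⟨a₀, ha₀, fun d s σ ⟨hs, hsd, _⟩ hσ A hA0 hA => ?_⟩
    obtain ⟨hA1, hAε⟩ := hsq A hA0 hA
    exact (le_minimaxTestRisk_thetaClass_sparseRate hs hsd hσ hε.le hA0 hA1 hAε).trans
      (minimaxTestRisk_mono (hlower d s _ (mul_pos hA0 (sparseRate_pos hs hsd hσ))))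

theorem isMinimaxTestingRate_thetaStarClass_denseRate :
    IsMinimaxTestingRate (fun d s => 1 ≤ s ∧ s ≤ d ∧ √(d : ℝ) ≤ s) thetaStarClass denseRate := by
  refine ⟨fun d s σ h hσ => denseRate_pos h.1 h.2.1 hσ, fun ε hε hε1 => ?_, fun ε hε _ => ?_⟩
  · obtain ⟨A₀, hA₀, hsq⟩ := exists_pos_forall_le_sq (64 / ε)
    exact ⟨A₀, hA₀, fun d s σ ⟨hs, hsd, _⟩ hσ A hA =>
      minimaxTestRisk_thetaStarClass_denseRate_le hs hsd hσ hε hε1.le (hA₀.trans hA).le (hsq A hA)⟩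
  · obtain ⟨a₀, ha₀, hsq⟩ := exists_pos_forall_sq_le (log_one_add_sq_pos hε)
    exact ⟨a₀, ha₀, fun d s σ ⟨hs, hsd, hds⟩ hσ A hA0 hA =>
      le_minimaxTestRisk_thetaStarClass_denseRate hs hsd hds hσ hε.le hA0 (hsq A hA0 hA).1
        (hsq A hA0 hA).2⟩

end TestingRates

theorem corollary2 :
    IsMinimaxTestingRate
      (fun d s => 1 ≤ s ∧ s ≤ d ∧ (s : ℝ) ≤ Real.sqrt (d : ℝ))
      thetaClass
      (fun d s σ => σ * Real.sqrt (Real.log (1 + (d : ℝ) / (s : ℝ) ^ 2))) ∧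
    IsMinimaxTestingRate
      (fun d s => 1 ≤ s ∧ s ≤ d)
      thetaStarClass
      (fun d s σ =>
        if (s : ℝ) < Real.sqrt (d : ℝ) then
          σ * Real.sqrt (Real.log (1 + (d : ℝ) / (s : ℝ) ^ 2))
        else
          σ * (d : ℝ) ^ ((1 : ℝ) / 4) / Real.sqrt (s : ℝ)) := by
  have hsubset : ∀ d s δ, 0 < δ → thetaClass d s δ ⊆ thetaStarClass d s δ := fun d s _ hδ =>
    thetaClass_subset_thetaStarClass d s hδ.le
  have hsparse : IsMinimaxTestingRate _ thetaStarClass sparseRate :=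
    isMinimaxTestingRate_sparseRate hsubset fun _ _ _ _ => subset_rfl
  refine ⟨isMinimaxTestingRate_sparseRate (fun _ _ _ _ => subset_rfl) hsubset, .ite ?_ ?_⟩
  · exact hsparse.mono fun d s ⟨⟨hs, hsd⟩, hlt⟩ => ⟨hs, hsd, hlt.le⟩
  · exact isMinimaxTestingRate_thetaStarClass_denseRate.mono
      fun d s ⟨⟨hs, hsd⟩, hge⟩ => ⟨hs, hsd, not_lt.1 hge⟩
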